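/- Let $K\subseteq\mathbb R$ be a field (for instance $K=\mathbb Q$ or $K=\mathbb R$) and let $\mathfrak g$ be a finite-dimensional semisimple Lie algebra over $K$ with a Hodge structure of weight zero compatible with the bracket: a decomposition $\mathfrak g_{\mathbb C}=\bigoplus_{k\in\mathbb Z}\mathfrak g^{k}$ of $\mathfrak g_{\mathbb C}=\mathfrak g\otimes_K\mathbb C$ into complex subspaces $\mathfrak g^k=\mathfrak g^{k,-k}$ such that $\overline{\mathfrak g^{k}}=\mathfrak g^{-k}$ and $[\mathfrak g^k,\mathfrak g^l]\subset\mathfrak g^{k+l}$. Write $\mathfrak g^+=\bigoplus_{k>0}\mathfrak g^k$. The level of a simple factor $\mathfrak s$ of $\mathfrak g_{\mathbb R}=\mathfrak g\otimes_K\mathbb R$ is the largest $k\ge 0$ with $\mathfrak s_{\mathbb C}\cap\mathfrak g^k\neq 0$, and the level $\ell(\mathfrak g)$ is the minimum of the levels of the simple factors of $\mathfrak g_{\mathbb R}$ (with $\ell(0)=0$). A sub-Hodge Lie algebra of $\mathfrak g$ is a $K$-Lie subalgebra $\mathfrak h\subset\mathfrak g$ such that $\mathfrak h_{\mathbb C}=\bigoplus_k\mathfrak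 h^k$, where $\mathfrak h^k=\mathfrak h_{\mathbb C}\cap\mathfrak g^k$; write $\mathfrak h^+=\bigoplus_{k>0}\mathfrak h^k$. Assume that $\mathfrak g^1$ generates $\mathfrak g^+$ under the Lie bracket and that $\ell(\mathfrak g)\ge 3$. Then: 1. If $\mathfrak h\subset\mathfrak g$ is a sub-Hodge Lie algebra with $\mathfrak h^k=\mathfrak g^k$ for all $k\ge 2$, then $\mathfrak h^+=\mathfrak g^+$; moreover $[\mathfrak g^{-2},\mathfrak g^{3}]\subset\mathfrak h_{\mathbb C}\cap\mathfrak g^1$. 2. The complex Lie subalgebra of $\mathfrak g_{\mathbb C}$ generated by all $\mathfrak g^{k}$ and $\mathfrak g^{-k}$ with $k\ge 2$ contains $\mathfrak g^{1}$ and $\mathfrak g^{-1}$. 3. $[\mathfrak g^{-2},\mathfrak g^{3}]\neq 0$. -/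

import Mathlib

open scoped TensorProduct

noncomputable section

namespace HodgeLie

section Complexification

variable (K : Type*) [Field K] [Algebra K ℝ] (L : Type*) [LieRing L] [LieAlgebra K L]

/-- Complex conjugation `z ⊗ x ↦ conj z ⊗ x` on the complexification of `L`. -/
def conj : ℂ ⊗[K] L →ₗ[K] ℂ ⊗[K] L :=
  LinearMap.rTensor L (Complex.conjAe.toLinearMap.restrictScalars K)

/-- The natural map `L_ℝ → L_ℂ`, sending `r ⊗ x` to `r ⊗ x`. -/
def realToComplex : ℝ ⊗[K] L →ₗ[K] ℂ ⊗[K] L :=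
  LinearMap.rTensor L (Complex.ofRealAm.toLinearMap.restrictScalars K)

/-- A Hodge structure of weight zero on the Lie algebra `L` over a subfield `K` of `ℝ`, for which
the Lie bracket is a morphism of Hodge structures.  `piece k` is the space `L^{k,-k}` of the Hodge
decomposition `L_ℂ = ⨁ L^{k,-k}`. -/
structure HodgeStructure where
  piece : ℤ → Submodule ℂ (ℂ ⊗[K] L)
  isInternal : DirectSum.IsInternal piece
  conj_mem : ∀ (k : ℤ) (x : ℂ ⊗[K] L), x ∈ piece k → conj K L x ∈ piece (-k)
  lie_mem : ∀ (i j : ℤ) (x y : ℂ ⊗[K] L), x ∈ piece i → y ∈ piece j → ⁅x, y⁆ ∈ piece (i + j)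

end Complexification

section Notions

variable {K : Type*} [Field K] [Algebra K ℝ] {L : Type*} [LieRing L] [LieAlgebra K L]

/-- The complexification, inside `L_ℂ`, of an ideal of `L_ℝ`. -/
def complexify (I : LieIdeal ℝ (ℝ ⊗[K] L)) : Submodule ℂ (ℂ ⊗[K] L) :=
  Submodule.span ℂ (realToComplex K L '' (I : Set (ℝ ⊗[K] L)))

namespace HodgeStructure

variable (φ : HodgeStructure K L)

/-- `L^+`, the sum of the `L^k` over all `k > 0`. -/
def plus : Submodule ℂ (ℂ ⊗[K] L) := ⨆ k : ℤ, ⨆ _ : 0 < k, φ.piece k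

/-- The level of an ideal `I` of `L_ℝ`: the largest `k ≥ 0` such that `I^k = I_ℂ ∩ L^k` is
nonzero. -/
def idealLevel (I : LieIdeal ℝ (ℝ ⊗[K] L)) : ℕ :=
  sSup {k : ℕ | complexify I ⊓ φ.piece (k : ℤ) ≠ ⊥}

/-- The level: the minimum of the levels of the simple factors (simple ideals) of `L_ℝ`.
It is `0` when there are none. -/
def level : ℕ :=
  sInf {n : ℕ | ∃ I : LieIdeal ℝ (ℝ ⊗[K] L), LieAlgebra.IsSimple ℝ I ∧ n = φ.idealLevel I}

/-- The piece `H^k = H_ℂ ∩ L^k` for a subalgebra `H` of `L`. -/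
def subPiece (H : LieSubalgebra K L) (k : ℤ) : Submodule ℂ (ℂ ⊗[K] L) :=
  H.toSubmodule.baseChange ℂ ⊓ φ.piece k

/-- A Lie subalgebra `H` of `L` is a sub-Hodge Lie algebra if `H_ℂ` is the sum of the
`H^k = H_ℂ ∩ L^k`. -/
def IsSubHodge (H : LieSubalgebra K L) : Prop :=
  H.toSubmodule.baseChange ℂ = ⨆ k : ℤ, φ.subPiece H k

/-- `H^+`, the sum of the `H^k` over all `k > 0`. -/
def subPlus (H : LieSubalgebra K L) : Submodule ℂ (ℂ ⊗[K] L) :=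
  ⨆ k : ℤ, ⨆ _ : 0 < k, φ.subPiece H k

/-- `L^1` generates `L^+` under the Lie bracket. -/
def OneGeneratesPlus : Prop :=
  (LieSubalgebra.lieSpan ℂ (ℂ ⊗[K] L) (φ.piece 1 : Set (ℂ ⊗[K] L))).toSubmodule = φ.plus

/-- The subalgebra of `L_ℂ` generated by all `L^k` and `L^{-k}` with `k ≥ 2`. -/
def outer : LieSubalgebra ℂ (ℂ ⊗[K] L) :=
  LieSubalgebra.lieSpan ℂ (ℂ ⊗[K] L)
    {x | ∃ k : ℤ, 2 ≤ k ∧ (x ∈ φ.piece k ∨ x ∈ φ.piece (-k))}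

end HodgeStructure

end Notions

end HodgeLie

end

/-! ### Operators satisfying partial `sl₂` relations -/

section Operators

/-! Write `g` for the complexified algebra. Its Killing form is nondegenerate and pairs `g^k` with
`g^{-k}`. The core is `LieGrading.piece_le_of_outer_le`: a subalgebra `O` containing every piece
with `|k| ≥ 2` contains `g^1` and `g^{-1}`.

Consider `g^0`-stable subspaces `A ⊆ g^1` and `B ⊆ g^{-1}` in perfect Killing duality. One such pair
is `[g^3, g^{-2}]`, `[g^{-3}, g^2]`, and any pair above it can be enlarged to `A + [g^2, B]`, `B +
[g^{-2}, A]`; all of this stays inside `O`. Duality holds because a degenerate vector `x` must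
vanish: choose `f` of degree `-1` such that `h = [x, f]` satisfies `[h, x] = 2x`. Orthogonality
makes `x` annihilate certain pieces, `h` has nonnegative integral eigenvalues on `ker (ad x)`, and
invariance of the form then conflicts with the weight `2` of `x`. For a maximal pair, the part of
`g^1` orthogonal to `B` commutes with `g^2`, with `A` and with itself, hence with `g^1`.

Since `g^1` generates `g^+`, that part centralizes `g^+`. The level hypothesis forces it to vanish:
a nonzero element of degree at most `2` centralizing `g^+` would yield a simple real factor living
in degrees `|j| ≤ 2`. The same fact gives `[g^{-2}, g^3] ≠ 0`. -/

theorem pow_succ_mul_of_commute_commutator {R : Type*} [Ring R] {A B C : R}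
    (hC : A * B - B * A = C) (hAC : A * C = C * A) (k : ℕ) :
    A ^ (k + 1) * B = B * A ^ (k + 1) + (k + 1 : ℕ) • (C * A ^ k) := by
  induction k with
  | zero => simp [← hC]
  | succ k ih =>
    have h2 : A * B = B * A + C := by rw [← hC]; abel
    rw [pow_succ' A (k + 1), mul_assoc, ih, mul_add, ← mul_assoc, h2, mul_smul_comm,
      ← mul_assoc A C, hAC, mul_assoc C A, ← pow_succ', add_mul, mul_assoc, ← pow_succ',
      succ_nsmul (C * A ^ (k + 1)) (k + 1)]
    abel

/-- If `A` is nilpotent and commutes with the commutator `C = AB - BA`, then `C` is nilpotent. -/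
theorem isNilpotent_commutator_of_commute (F : Type*) [Field F] [CharZero F] {R : Type*}
    [Ring R] [Algebra F R] {A B C : R}
    (hC : A * B - B * A = C) (hAC : A * C = C * A) (hA : IsNilpotent A) : IsNilpotent C := by
  obtain ⟨N, hN⟩ := hA
  have hAC' : Commute A C := hAC
  have hpow := pow_succ_mul_of_commute_commutator hC hAC
  -- Powers of `A` are traded for powers of `C`: multiplying the formula for `A ^ (l + 1) * B` by `C
  -- ^ m` on both sides kills all but a multiple of `C ^ (m + 1) * A ^ l * C ^ m`.
  have key : ∀ k : ℕ, ∃ m : ℕ, A ^ (N - k) * C ^ m = 0 := by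
    intro k
    induction k with
    | zero => exact ⟨0, by simp [hN]⟩
    | succ k ih =>
      obtain ⟨m, hm⟩ := ih
      rcases Nat.lt_or_ge k N with hk | hk
      · obtain ⟨l, hl⟩ : ∃ l, N - k = l + 1 := ⟨N - k - 1, by omega⟩
        have hl' : N - (k + 1) = l := by omega
        rw [hl] at hm
        rw [hl']
        refine ⟨m + 1 + m, ?_⟩
        have hcm : C ^ m * A ^ (l + 1) = 0 := by
          rw [← ((hAC'.pow_pow (l + 1) m).eq), hm]
        have h1 : C ^ m * (A ^ (l + 1) * B) * C ^ m = 0 := by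
          rw [← mul_assoc, hcm, zero_mul, zero_mul]
        rw [hpow, mul_add, add_mul, mul_assoc, mul_assoc, hm, mul_zero, mul_zero,
          zero_add, mul_smul_comm, ← mul_assoc, ← pow_succ, smul_mul_assoc] at h1
        have h2 : C ^ (m + 1) * A ^ l * C ^ m = 0 := by
          have h3 : ((l + 1 : ℕ) : F) • (C ^ (m + 1) * A ^ l * C ^ m) = 0 := by
            rw [Nat.cast_smul_eq_nsmul]; exact h1
          exact (smul_eq_zero_iff_right (Nat.cast_ne_zero.2 l.succ_ne_zero)).1 h3
        rwa [← (hAC'.pow_pow l (m + 1)).eq, mul_assoc, ← pow_add] at h2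
      · exact ⟨m, by rwa [Nat.sub_eq_zero_of_le (by omega)] at hm ⊢⟩
  obtain ⟨m, hm⟩ := key N
  exact ⟨m, by simpa using hm⟩

/-- If `A` is nilpotent and commutes with the commutator `AB - BA`, then `AB` is nilpotent. -/
theorem isNilpotent_mul_of_commute_commutator (F : Type*) [Field F] [CharZero F]
    {R : Type*} [Ring R] [Algebra F R] {A B C : R}
    (hC : A * B - B * A = C) (hAC : A * C = C * A) (hA : IsNilpotent A) :
    IsNilpotent (A * B) := by
  obtain ⟨M, hM⟩ := isNilpotent_commutator_of_commute F hC hAC hA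
  obtain ⟨N, hN⟩ := hA
  have hAC' : Commute A C := hAC
  have hpow := pow_succ_mul_of_commute_commutator hC hAC
  -- On the kernel of `A ^ (k + 1)` modulo that of `A ^ k`, `A * B` acts as `(k + 1) • C`, which is
  -- nilpotent.
  have step : ∀ (k : ℕ) (w : R), A ^ (k + 1) * w = 0 → ∀ n : ℕ,
      A ^ (k + 1) * ((A * B) ^ n * w) = 0 ∧
      A ^ k * ((A * B) ^ n * w) = (k + 1 : ℕ) ^ n • (C ^ n * (A ^ k * w)) := by
    intro k w hw n
    induction n with
    | zero => simpa using hw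
    | succ n ih =>
      have e : A ^ k * ((A * B) ^ (n + 1) * w) =
          (k + 1 : ℕ) • (C * (A ^ k * ((A * B) ^ n * w))) := by
        rw [pow_succ' (A * B), mul_assoc, ← mul_assoc (A ^ k), ← mul_assoc (A ^ k), ← pow_succ,
          hpow, add_mul, mul_assoc B, ih.1, mul_zero, zero_add, smul_mul_assoc, mul_assoc]
      refine ⟨?_, ?_⟩
      · rw [pow_succ', mul_assoc, e, mul_smul_comm, ← mul_assoc, hAC, mul_assoc, ← mul_assoc A,
          ← pow_succ', ih.1, mul_zero, smul_zero]
      · rw [e, ih.2, mul_smul_comm, ← mul_assoc, ← pow_succ', smul_smul, ← pow_succ']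
  have key : ∀ k : ℕ, ∃ m : ℕ, A ^ (N - k) * (A * B) ^ m = 0 := by
    intro k
    induction k with
    | zero => exact ⟨0, by simp [hN]⟩
    | succ k ih =>
      obtain ⟨m, hm⟩ := ih
      rcases Nat.lt_or_ge k N with hk | hk
      · obtain ⟨l, hl⟩ : ∃ l, N - k = l + 1 := ⟨N - k - 1, by omega⟩
        have hl' : N - (k + 1) = l := by omega
        rw [hl] at hm
        rw [hl']
        refine ⟨M + m, ?_⟩
        rw [pow_add, (step l _ hm M).2, hM, zero_mul, smul_zero]
      · exact ⟨m, by rwa [Nat.sub_eq_zero_of_le (by omega)] at hm ⊢⟩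
  obtain ⟨m, hm⟩ := key N
  exact ⟨m, by simpa using hm⟩

/-! ### Nonnegative integral eigenvalues on the kernel of a raising operator. -/

open Polynomial

variable {F V : Type*} [Field F] [CharZero F] [AddCommGroup V] [Module F V]

/-- The polynomial `X (X - 1) ⋯ (X - (n - 1))`. -/
noncomputable def fallingPoly (F : Type*) [Field F] (n : ℕ) : F[X] :=
  ∏ j ∈ Finset.range n, (X - C (j : F))

/-- The sum of the eigenspaces of `D` with nonnegative integral eigenvalue. -/
def natEigenspaces (D : Module.End F V) : Submodule F V :=
  ⨆ j : ℕ, Module.End.eigenspace D (j : F)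

/-- The linear factors are pairwise coprime in characteristic zero, so the kernel of the product is
the sum of the kernels. -/
theorem mem_natEigenspaces_of_aeval_fallingPoly {D : Module.End F V} (n : ℕ) :
    ∀ v : V, aeval D (fallingPoly F n) v = 0 → v ∈ natEigenspaces D := by
  induction n with
  | zero => intro v hv; simp [fallingPoly] at hv; simp [hv]
  | succ n ih =>
    intro v hv
    have hcop : IsCoprime (fallingPoly F n) (X - C (n : F)) := by
      refine IsCoprime.prod_left fun j hj => ?_
      refine isCoprime_X_sub_C_of_isUnit_sub ?_
      rw [isUnit_iff_ne_zero, sub_ne_zero]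
      exact_mod_cast (Finset.mem_range.1 hj).ne
    have h := Polynomial.sup_ker_aeval_eq_ker_aeval_mul_of_coprime D hcop
    have hv' : v ∈ LinearMap.ker (aeval D (fallingPoly F n * (X - C (n : F)))) := by
      rw [LinearMap.mem_ker, ← hv, fallingPoly, fallingPoly, Finset.prod_range_succ]
    rw [← h] at hv'
    obtain ⟨a, ha, b, hb, rfl⟩ := Submodule.mem_sup.1 hv'
    refine add_mem (ih a ha) (Submodule.mem_iSup_of_mem n ?_)
    rw [Module.End.mem_eigenspace_iff]
    simpa [sub_eq_zero, Nat.cast_smul_eq_nsmul] using hb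

theorem eq_zero_of_mem_natEigenspaces {D : Module.End F V} {v : V} (hv : v ∈ natEigenspaces D)
    (n : ℕ) (hn : n ≠ 0) (h : D v = (-(n : F)) • v) : v = 0 := by
  have hind := Module.End.eigenspaces_iSupIndep D (-(n : F))
  refine (Submodule.disjoint_def.1 hind) v (Module.End.mem_eigenspace_iff.2 h) ?_
  refine (iSup_le fun j : ℕ => ?_ : natEigenspaces D ≤ _) hv
  refine le_iSup₂_of_le (j : F) ?_ le_rfl
  intro hj
  have : ((j + n : ℕ) : F) = 0 := by push_cast; rw [hj]; ring
  have := Nat.cast_eq_zero.1 this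
  omega

/-- If `[H, X] = 2X` and `H = [X, Y]` with `X` nilpotent, then `H` is diagonalisable on `ker X`
with nonnegative integral eigenvalues. -/
theorem exists_aeval_fallingPoly_eq_zero {X Y H : Module.End F V} (hH : X * Y - Y * X = H)
    (hHX : H * X - X * H = (2 : F) • X) (hX : IsNilpotent X) :
    ∃ n : ℕ, ∀ v, X v = 0 → aeval H (fallingPoly F n) v = 0 := by
  obtain ⟨N, hN⟩ := hX
  have hXY : ∀ v, X (Y v) = Y (X v) + H v := fun v => by
    have := LinearMap.congr_fun hH v
    simp only [LinearMap.sub_apply, Module.End.mul_apply] at this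
    rw [← this]; abel
  have hXH : ∀ v, X (H v) = H (X v) - (2 : F) • X v := fun v => by
    have := LinearMap.congr_fun hHX v
    simp only [LinearMap.sub_apply, Module.End.mul_apply, LinearMap.smul_apply] at this
    rw [← this]; abel
  have hpow : ∀ (n : ℕ) (v : V), (X ^ (n + 1)) (Y v) = Y ((X ^ (n + 1)) v) +
      (n + 1 : F) • (H ((X ^ n) v) - (n : F) • (X ^ n) v) := by
    intro n v
    induction n with
    | zero => simp [hXY]
    | succ n ih =>
      rw [pow_succ' X (n + 1), Module.End.mul_apply, ih, map_add, map_smul, map_sub, map_smul,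
        hXY, hXH]
      simp only [← Module.End.mul_apply, ← pow_succ']
      push_cast
      module
  -- `H - n` maps `ker X ∩ im (X ^ n)` into `ker X ∩ im (X ^ (n + 1))`: if `v = X ^ n w`, then `(n +
  -- 1) (H - n) v = X ^ (n + 1) (Y w)`.
  have key : ∀ (n : ℕ) (v : V), X v = 0 →
      X (aeval H (fallingPoly F n) v) = 0 ∧ ∃ w, aeval H (fallingPoly F n) v = (X ^ n) w := by
    intro n v hv
    induction n with
    | zero => exact ⟨by simpa [fallingPoly] using hv, v, by simp [fallingPoly]⟩
    | succ n ih =>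
      obtain ⟨h0, w, hw⟩ := ih
      have e : aeval H (fallingPoly F (n + 1)) v =
          H (aeval H (fallingPoly F n) v) - (n : F) • aeval H (fallingPoly F n) v := by
        rw [fallingPoly, Finset.prod_range_succ, mul_comm, map_mul, Module.End.mul_apply]
        simp [fallingPoly, Nat.cast_smul_eq_nsmul]
      refine ⟨?_, ((n + 1 : F)⁻¹) • Y w, ?_⟩
      · rw [e, map_sub, hXH, map_smul, h0]; simp
      · have h1 := hpow n w
        rw [pow_succ' X n, Module.End.mul_apply, Module.End.mul_apply, ← hw, h0, map_zero,
          zero_add] at h1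
        have hn : (n + 1 : F) ≠ 0 := by exact_mod_cast Nat.succ_ne_zero n
        rw [e, map_smul, pow_succ' X n, Module.End.mul_apply, h1, smul_smul, inv_mul_cancel₀ hn,
          one_smul]
  refine ⟨N, fun v hv => ?_⟩
  obtain ⟨-, w, hw⟩ := key N v hv
  rw [hw, hN]; rfl

end Operators

/-! ### Graded Lie algebras with nondegenerate Killing form -/

/-- A grading of a Lie algebra by the integers. -/
structure LieGrading (F V : Type*) [Field F] [LieRing V] [LieAlgebra F V] where
  piece : ℤ → Submodule F V
  isInternal : DirectSum.IsInternal piece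
  lie_mem : ∀ {i j : ℤ} {x y : V}, x ∈ piece i → y ∈ piece j → ⁅x, y⁆ ∈ piece (i + j)

namespace LieGrading

open LieAlgebra LieModule

variable {F V : Type*} [Field F] [LieRing V] [LieAlgebra F V] (G : LieGrading F V)

/-- The opposite grading. -/
def rev : LieGrading F V where
  piece k := G.piece (-k)
  isInternal := by
    rw [DirectSum.isInternal_submodule_iff_iSupIndep_and_iSup_eq_top]
    refine ⟨G.isInternal.submodule_iSupIndep.comp neg_injective, ?_⟩
    rw [← G.isInternal.submodule_iSup_eq_top]
    exact (Equiv.neg ℤ).iSup_comp (g := G.piece)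
  lie_mem {i j} _ _ hx hy := by rw [neg_add]; exact G.lie_mem hx hy

@[simp] theorem rev_piece (k : ℤ) : G.rev.piece k = G.piece (-k) := rfl

theorem lie_mem_of_add_eq {i j k : ℤ} {x y : V} (hx : x ∈ G.piece i) (hy : y ∈ G.piece j)
    (h : i + j = k) : ⁅x, y⁆ ∈ G.piece k := h ▸ G.lie_mem hx hy

theorem iSup_piece : ⨆ i, G.piece i = ⊤ := G.isInternal.submodule_iSup_eq_top

/-- An element is zero if it is homogeneous and lies in the sum of the other pieces. -/
theorem eq_zero_of_mem_of_mem_iSup {P : ℤ → Prop} {k : ℤ} (hk : ¬ P k) {x : V}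
    (hx : x ∈ G.piece k) (h : x ∈ ⨆ j, ⨆ _ : P j, G.piece j) : x = 0 := by
  refine (Submodule.disjoint_def.1 (G.isInternal.submodule_iSupIndep k)) x hx ?_
  refine (iSup₂_le fun j hj => ?_ : (⨆ j, ⨆ _ : P j, G.piece j) ≤ _) h
  exact le_iSup₂_of_le j (by rintro rfl; exact hk hj) le_rfl

/-- A homogeneous element in the image of a homogeneous operator is the image of a homogeneous
element. -/
theorem exists_preimage (T : Module.End F V) (d : ℤ)
    (hT : ∀ i, ∀ v ∈ G.piece i, T v ∈ G.piece (i + d)) (k : ℤ) (v : V)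
    (h : T v ∈ G.piece (k + d)) : ∃ w ∈ G.piece k, T w = T v := by
  have key : ∃ w ∈ G.piece k, T v - T w ∈ ⨆ j, ⨆ _ : j ≠ k + d, G.piece j := by
    have hv : v ∈ ⨆ i, G.piece i := by rw [G.iSup_piece]; trivial
    clear h
    induction hv using Submodule.iSup_induction' with
    | mem i x hx =>
      by_cases hi : i = k
      · subst hi
        exact ⟨x, hx, by simp⟩
      · refine ⟨0, zero_mem _, ?_⟩
        rw [map_zero, sub_zero]
        exact Submodule.mem_iSup_of_mem (i + d)
          (Submodule.mem_iSup_of_mem (by omega) (hT i x hx))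
    | zero => exact ⟨0, zero_mem _, by simp⟩
    | add x y _ _ hx hy =>
      obtain ⟨a, ha, ha'⟩ := hx
      obtain ⟨b, hb, hb'⟩ := hy
      refine ⟨a + b, add_mem ha hb, ?_⟩
      rw [map_add, map_add, add_sub_add_comm]
      exact add_mem ha' hb'
  obtain ⟨w, hw, hw'⟩ := key
  refine ⟨w, hw, (sub_eq_zero.1 ?_).symm⟩
  exact G.eq_zero_of_mem_of_mem_iSup (P := fun j => j ≠ k + d) (by simp)
    (sub_mem h (hT k w hw)) hw'

theorem killingForm_lie (x y z : V) : killingForm F V ⁅x, y⁆ z = killingForm F V x ⁅y, z⁆ :=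
  traceForm_apply_lie_apply F V V x y z

theorem killingForm_lie' (x y z : V) : killingForm F V ⁅x, y⁆ z = - killingForm F V y ⁅x, z⁆ := by
  rw [← lie_skew, map_neg, LinearMap.neg_apply, killingForm_lie]

variable [Module.Finite F V]

theorem exists_bound : ∃ n : ℕ, ∀ k : ℤ, n < |k| → G.piece k = ⊥ := by
  have hfin : {i | G.piece i ≠ ⊥}.Finite :=
    WellFoundedGT.finite_ne_bot_of_iSupIndep G.isInternal.submodule_iSupIndep
  obtain ⟨n, hn⟩ := (hfin.image Int.natAbs).bddAbove
  refine ⟨n, fun k hk => ?_⟩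
  by_contra h
  have := hn ⟨k, h, rfl⟩
  rw [Int.abs_eq_natAbs] at hk
  omega

theorem isNilpotent_ad {x : V} (hx : x ∈ G.piece 1) : IsNilpotent (ad F V x) := by
  obtain ⟨n, hn⟩ := G.exists_bound
  have hpow : ∀ (m : ℕ) (i : ℤ) (v : V), v ∈ G.piece i → ((ad F V x) ^ m) v ∈ G.piece (i + m) := by
    intro m i v hv
    induction m with
    | zero => simpa using hv
    | succ m ih =>
      rw [pow_succ', Module.End.mul_apply, ad_apply]
      exact G.lie_mem_of_add_eq hx ih (by push_cast; ring)
  refine ⟨2 * n + 1, LinearMap.ext fun v => ?_⟩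
  have hv : v ∈ ⨆ i, G.piece i := by rw [G.iSup_piece]; trivial
  induction hv using Submodule.iSup_induction' with
  | mem i v hv =>
    rcases lt_or_ge i (-n) with hi | hi
    · rw [hn i (by rw [abs_of_neg (by omega)]; omega)] at hv
      rw [(Submodule.mem_bot F).1 hv, map_zero, map_zero]
    · have := hpow (2 * n + 1) i v hv
      rw [hn _ (by rw [abs_of_pos (by push_cast; omega)]; push_cast; omega)] at this
      simpa using this
  | zero => simp
  | add a b _ _ ha hb => rw [map_add, ha, hb]; simp

theorem killingForm_eq_zero {i j : ℤ} (hij : i + j ≠ 0) {x y : V} (hx : x ∈ G.piece i)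
    (hy : y ∈ G.piece j) : killingForm F V x y = 0 := by
  rw [killingForm_apply_apply]
  refine LinearMap.trace_eq_zero_of_mapsTo_ne G.isInternal (fun k => i + (j + k))
    (fun k => by omega) (fun k v hv => ?_)
  exact G.lie_mem hx (G.lie_mem hy hv)

variable [IsKilling F V]

theorem eq_zero_of_killingForm {i j : ℤ} (hij : i + j = 0) {x : V} (hx : x ∈ G.piece i)
    (h : ∀ y ∈ G.piece j, killingForm F V x y = 0) : x = 0 := by
  refine (IsKilling.killingForm_nondegenerate F V).1 x fun y => ?_
  have hy : y ∈ ⨆ i, G.piece i := by rw [G.iSup_piece]; trivial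
  induction hy using Submodule.iSup_induction' with
  | mem k y hy =>
    by_cases hk : k = j
    · exact h y (hk ▸ hy)
    · exact G.killingForm_eq_zero (by omega) hx hy
  | zero => simp
  | add a b _ _ ha hb => rw [map_add, ha, hb, add_zero]

variable [CharZero F]

/-- A graded version of half of the Jacobson–Morozov theorem. -/
theorem exists_lie_lie_eq {x : V} (hx : x ∈ G.piece 1) :
    ∃ f ∈ G.piece (-1), ⁅⁅x, f⁆, x⁆ = (2 : F) • x := by
  have hinv : ∀ u v : V, killingForm F V (ad F V x (ad F V x u)) v =
      killingForm F V u (ad F V x (ad F V x v)) := fun u v => by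
    simp only [ad_apply]
    rw [killingForm_lie', killingForm_lie', neg_neg]
  let T : Module.End F V := ad F V x * ad F V x
  -- `T` is self-adjoint for the Killing form, so its image is the orthogonal of its kernel. If `⁅x,
  -- ⁅x, z⁆⁆ = 0`, then `ad x` commutes with `ad ⁅x, z⁆`, so `ad x * ad z` is nilpotent and has
  -- trace zero.
  have hmem : x ∈ LinearMap.range T := by
    have hB := IsKilling.killingForm_nondegenerate F V
    have hr : (killingForm F V).IsRefl := (traceForm_isSymm F V V).isRefl
    rw [← LinearMap.BilinForm.orthogonal_orthogonal hB hr (LinearMap.range T)]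
    rw [LinearMap.BilinForm.mem_orthogonal_iff]
    intro z hz
    rw [LinearMap.BilinForm.mem_orthogonal_iff] at hz
    have hTz : ⁅x, ⁅x, z⁆⁆ = 0 := by
      refine hB.2 _ fun u => ?_
      have := hz (T u) ⟨u, rfl⟩
      rwa [Module.End.mul_apply, hinv] at this
    rw [traceForm_comm, killingForm_apply_apply]
    refine (LinearMap.isNilpotent_trace_of_isNilpotent
      (isNilpotent_mul_of_commute_commutator F (C := ad F V ⁅x, z⁆) ?_ ?_
        (G.isNilpotent_ad hx))).eq_zero
    · exact LinearMap.ext fun v => (lie_lie x z v).symm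
    · refine LinearMap.ext fun v => ?_
      have := lie_lie x ⁅x, z⁆ v
      rw [hTz, zero_lie] at this
      exact sub_eq_zero.1 this.symm
  obtain ⟨y, hy⟩ := hmem
  obtain ⟨w, hw, hw'⟩ := G.exists_preimage T 2 (fun i v hv => by
    refine G.lie_mem_of_add_eq hx (G.lie_mem hx hv) (by ring)) (-1) y (by
    rw [hy]; exact hx)
  refine ⟨(-2 : F) • w, Submodule.smul_mem _ _ hw, ?_⟩
  rw [hy] at hw'
  have : ⁅x, ⁅x, w⁆⁆ = x := hw'
  rw [lie_smul, smul_lie, ← lie_skew, this]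
  module

end LieGrading

/-! ### Eigenvalues of `⁅x, f⁆` and invariance of the Killing form. -/

namespace LieGrading

open LieAlgebra LieModule Polynomial

variable {F V : Type*} [Field F] [LieRing V] [LieAlgebra F V] (G : LieGrading F V)

theorem aeval_ad_mem {h : V} (hh : h ∈ G.piece 0) (p : F[X]) {k : ℤ} {v : V}
    (hv : v ∈ G.piece k) : aeval (ad F V h) p v ∈ G.piece k := by
  have hpow : ∀ n : ℕ, ((ad F V h) ^ n) v ∈ G.piece k := by
    intro n
    induction n with
    | zero => exact hv
    | succ n ih =>
      rw [pow_succ', Module.End.mul_apply, ad_apply]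
      exact G.lie_mem_of_add_eq hh ih (zero_add k)
  induction p using Polynomial.induction_on' with
  | add p q hp hq => rw [map_add, LinearMap.add_apply]; exact add_mem hp hq
  | monomial n a =>
    rw [aeval_monomial, Module.End.mul_apply, Module.algebraMap_end_apply]
    exact Submodule.smul_mem _ _ (hpow n)

theorem killingForm_aeval_ad (h u v : V) (p : F[X]) :
    killingForm F V (aeval (ad F V (-h)) p u) v = killingForm F V u (aeval (ad F V h) p v) := by
  induction p using Polynomial.induction_on' with
  | add p q hp hq =>
    rw [map_add, map_add, LinearMap.add_apply, LinearMap.add_apply, map_add, map_add,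
      LinearMap.add_apply, hp, hq]
  | monomial n a =>
    have key : ∀ (n : ℕ) (u : V), killingForm F V (((ad F V (-h)) ^ n) u) v =
        killingForm F V u (((ad F V h) ^ n) v) := by
      intro n
      induction n with
      | zero => intro u; rfl
      | succ n ih =>
        intro u
        rw [pow_succ, Module.End.mul_apply, ih, pow_succ', Module.End.mul_apply, ad_apply,
          ad_apply, killingForm_lie', neg_lie, map_neg, neg_neg]
    rw [aeval_monomial, aeval_monomial, Module.End.mul_apply, Module.End.mul_apply,
      Module.algebraMap_end_apply, Module.algebraMap_end_apply, map_smul, map_smul,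
      LinearMap.smul_apply, key]

section

theorem lie_mem_natEigenspaces {h u v : V} (hu : u ∈ natEigenspaces (ad F V h))
    (hv : v ∈ natEigenspaces (ad F V h)) : ⁅u, v⁆ ∈ natEigenspaces (ad F V h) := by
  unfold natEigenspaces at hu
  induction hu using Submodule.iSup_induction' with
  | mem i u hu =>
    rw [Module.End.mem_eigenspace_iff, ad_apply] at hu
    unfold natEigenspaces at hv
    induction hv using Submodule.iSup_induction' with
    | mem j v hv =>
      rw [Module.End.mem_eigenspace_iff, ad_apply] at hv
      refine Submodule.mem_iSup_of_mem (i + j) ?_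
      rw [Module.End.mem_eigenspace_iff, ad_apply, leibniz_lie, hu, hv, smul_lie, lie_smul,
        ← add_smul, Nat.cast_add]
    | zero => simp
    | add a b _ _ ha hb => rw [lie_add]; exact add_mem ha hb
  | zero => simp
  | add a b _ _ ha hb => rw [add_lie]; exact add_mem ha hb

variable [CharZero F]

/-- For eigenvalues `i, j ≥ 0`, invariance gives `(i + j) * killingForm u v = 0`; either the form
vanishes, or `j = 0` and `⁅h, v⁆ = 0`. -/
theorem killingForm_lie_eq_zero_of_mem_natEigenspaces {h u v : V}
    (hu : u ∈ natEigenspaces (ad F V h)) (hv : v ∈ natEigenspaces (ad F V h)) :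
    killingForm F V u ⁅h, v⁆ = 0 := by
  unfold natEigenspaces at hu hv
  induction hu using Submodule.iSup_induction' with
  | mem i u hu =>
    rw [Module.End.mem_eigenspace_iff, ad_apply] at hu
    induction hv using Submodule.iSup_induction' with
    | mem j v hv =>
      rw [Module.End.mem_eigenspace_iff, ad_apply] at hv
      have h1 := killingForm_lie' (F := F) h u v
      rw [hu, hv, map_smul, map_smul, LinearMap.smul_apply, ← sub_eq_zero, sub_neg_eq_add,
        ← add_smul, smul_eq_mul, mul_eq_zero] at h1
      rw [hv, map_smul, smul_eq_mul, mul_eq_zero]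
      refine h1.imp_left fun h2 => ?_
      have : ((i + j : ℕ) : F) = 0 := by exact_mod_cast h2
      have := Nat.cast_eq_zero.1 this
      exact_mod_cast (by omega : j = 0)
    | zero => simp
    | add a b _ _ ha hb => rw [lie_add, map_add, ha, hb, add_zero]
  | zero => simp
  | add a b _ _ ha hb => rw [map_add, LinearMap.add_apply, ha, hb, add_zero]

variable [Module.Finite F V]

theorem exists_aeval_ad_fallingPoly {x f : V} (hx : x ∈ G.piece 1)
    (hf : ⁅⁅x, f⁆, x⁆ = (2 : F) • x) :
    ∃ n : ℕ, ∀ v : V, ⁅x, v⁆ = 0 → aeval (ad F V ⁅x, f⁆) (fallingPoly F n) v = 0 := by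
  refine exists_aeval_fallingPoly_eq_zero (X := ad F V x) (Y := ad F V f) ?_ ?_
    (G.isNilpotent_ad hx)
  · exact LinearMap.ext fun v => (lie_lie x f v).symm
  · refine LinearMap.ext fun v => ?_
    have := lie_lie ⁅x, f⁆ x v
    rw [hf, smul_lie] at this
    exact this.symm

theorem mem_natEigenspaces_of_lie_eq_zero {x f : V} (hx : x ∈ G.piece 1)
    (hf : ⁅⁅x, f⁆, x⁆ = (2 : F) • x) {v : V} (hv : ⁅x, v⁆ = 0) :
    v ∈ natEigenspaces (ad F V ⁅x, f⁆) := by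
  obtain ⟨n, hn⟩ := G.exists_aeval_ad_fallingPoly hx hf
  exact mem_natEigenspaces_of_aeval_fallingPoly n v (hn v hv)

/-- Killing duality between degrees `k` and `l` makes `ad (-⁅x, f⁆)` in degree `k` the transpose of
`ad ⁅x, f⁆` in degree `l`, where `x` acts by zero and the eigenvalues are nonnegative. -/
theorem mem_natEigenspaces_neg {x f : V} (hx : x ∈ G.piece 1) (hf1 : f ∈ G.piece (-1))
    (hf : ⁅⁅x, f⁆, x⁆ = (2 : F) • x) [IsKilling F V] {k l : ℤ} (hkl : k + l = 0)
    (hl : ∀ v ∈ G.piece l, ⁅x, v⁆ = 0) {u : V} (hu : u ∈ G.piece k) :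
    u ∈ natEigenspaces (ad F V (-⁅x, f⁆)) := by
  obtain ⟨n, hn⟩ := G.exists_aeval_ad_fallingPoly hx hf
  refine mem_natEigenspaces_of_aeval_fallingPoly n u ?_
  have h0 : -⁅x, f⁆ ∈ G.piece 0 := neg_mem (G.lie_mem_of_add_eq hx hf1 (by norm_num))
  refine G.eq_zero_of_killingForm hkl (G.aeval_ad_mem h0 _ hu) fun v hv => ?_
  rw [killingForm_aeval_ad, hn v (hl v hv), map_zero]

end

/-! ### Brackets of pieces and dual pairs in degrees `1` and `-1`. -/

/-- The span of the brackets of elements of two subspaces. -/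
def lieSpan₂ (S T : Submodule F V) : Submodule F V :=
  Submodule.map₂ (LieModule.toEnd F V V : V →ₗ[F] Module.End F V) S T

theorem lie_mem_lieSpan₂ {S T : Submodule F V} {x y : V} (hx : x ∈ S) (hy : y ∈ T) :
    ⁅x, y⁆ ∈ lieSpan₂ S T := Submodule.apply_mem_map₂ _ hx hy

theorem lieSpan₂_le {S T U : Submodule F V} : lieSpan₂ S T ≤ U ↔ ∀ x ∈ S, ∀ y ∈ T, ⁅x, y⁆ ∈ U :=
  Submodule.map₂_le

/-- If `x` of degree one is a sum of brackets of elements of degrees `3` and `-2`, and is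
orthogonal to all brackets of elements of degrees `-3` and `2`, then `x = 0`. -/
theorem eq_zero_of_mem_lieSpan₂ [CharZero F] [Module.Finite F V] [IsKilling F V] {x : V}
    (hx : x ∈ lieSpan₂ (G.piece 3) (G.piece (-2)))
    (hx' : ∀ y ∈ lieSpan₂ (G.piece (-3)) (G.piece 2), killingForm F V x y = 0) : x = 0 := by
  have hx1 : x ∈ G.piece 1 :=
    lieSpan₂_le.2 (fun u hu v hv => G.lie_mem_of_add_eq hu hv (by norm_num)) hx
  obtain ⟨f, hf1, hf⟩ := G.exists_lie_lie_eq hx1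
  have h2 : ∀ v ∈ G.piece 2, ⁅x, v⁆ = 0 := fun v hv => by
    refine G.eq_zero_of_killingForm (j := -3) (by norm_num)
      (G.lie_mem_of_add_eq hx1 hv (by norm_num : (1 : ℤ) + 2 = 3)) fun w hw => ?_
    rw [killingForm_lie, ← lie_skew, map_neg, hx' _ (lie_mem_lieSpan₂ hw hv), neg_zero]
  have h3 : ∀ v ∈ G.piece (-3), ⁅x, v⁆ = 0 := fun v hv => by
    refine G.eq_zero_of_killingForm (j := 2) (by norm_num)
      (G.lie_mem_of_add_eq hx1 hv (by norm_num : (1 : ℤ) + -3 = -2)) fun w hw => ?_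
    rw [killingForm_lie, hx' _ (lie_mem_lieSpan₂ hv hw)]
  -- `-⁅x, f⁆` has nonnegative eigenvalues in degrees `3` and `-2`, dual to `-3` and `2`, hence on
  -- their brackets; but its eigenvalue on `x` is `-2`.
  have hmem : x ∈ natEigenspaces (ad F V (-⁅x, f⁆)) := by
    refine lieSpan₂_le.2 (fun u hu v hv => lie_mem_natEigenspaces ?_ ?_) hx
    · exact G.mem_natEigenspaces_neg hx1 hf1 hf (by norm_num) h3 hu
    · exact G.mem_natEigenspaces_neg hx1 hf1 hf (by norm_num) h2 hv
  refine eq_zero_of_mem_natEigenspaces hmem 2 (by norm_num) ?_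
  rw [ad_apply, neg_lie, hf, neg_smul, Nat.cast_ofNat]

/-- Subspaces of degrees `1` and `-1`, stable under the degree zero part, in duality through the
Killing form. -/
structure IsDualPair (A B : Submodule F V) : Prop where
  left_le : A ≤ G.piece 1
  right_le : B ≤ G.piece (-1)
  lie_left : ∀ z ∈ G.piece 0, ∀ a ∈ A, ⁅z, a⁆ ∈ A
  lie_right : ∀ z ∈ G.piece 0, ∀ b ∈ B, ⁅z, b⁆ ∈ B
  separating_left : ∀ a ∈ A, (∀ b ∈ B, killingForm F V a b = 0) → a = 0
  separating_right : ∀ b ∈ B, (∀ a ∈ A, killingForm F V b a = 0) → b = 0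

variable {G}

theorem IsDualPair.rev {A B : Submodule F V} (h : G.IsDualPair A B) : G.rev.IsDualPair B A where
  left_le := h.right_le
  right_le := by simpa using h.left_le
  lie_left := by simpa using h.lie_right
  lie_right := by simpa using h.lie_left
  separating_left := h.separating_right
  separating_right := h.separating_left

variable [Module.Finite F V]

/-- `A` and `B` are isotropic for degree reasons and dual to each other, so `A ⊔ B` splits off its
orthogonal. The `B`-component of `x` can be left in the remainder `c`, since it is orthogonal to
`B`. -/
theorem exists_add_of_isDualPair {A B : Submodule F V} (h : G.IsDualPair A B) {x : V}
    (hx : x ∈ G.piece 1) :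
    ∃ a ∈ A, ∃ c ∈ G.piece 1, (∀ b ∈ B, killingForm F V c b = 0) ∧ x = a + c := by
  have hr : (killingForm F V).IsRefl := (traceForm_isSymm F V V).isRefl
  have hAA : ∀ a ∈ A, ∀ a' ∈ A, killingForm F V a a' = 0 := fun a ha a' ha' =>
    G.killingForm_eq_zero (by norm_num) (h.left_le ha) (h.left_le ha')
  have hBB : ∀ a ∈ B, ∀ a' ∈ B, killingForm F V a a' = 0 := fun a ha a' ha' =>
    G.killingForm_eq_zero (by norm_num) (h.right_le ha) (h.right_le ha')
  have hdisj : Disjoint (A ⊔ B) ((killingForm F V).orthogonal (A ⊔ B)) := by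
    refine Submodule.disjoint_def.2 fun v hv hv' => ?_
    rw [LinearMap.BilinForm.mem_orthogonal_iff] at hv'
    obtain ⟨a, ha, b, hb, rfl⟩ := Submodule.mem_sup.1 hv
    have ha0 : a = 0 := h.separating_left a ha fun b' hb' => by
      have := hv' b' (Submodule.mem_sup_right hb')
      rwa [map_add, hBB b' hb' b hb, add_zero, traceForm_comm] at this
    have hb0 : b = 0 := h.separating_right b hb fun a' ha' => by
      have := hv' a' (Submodule.mem_sup_left ha')
      rwa [map_add, hAA a' ha' a ha, zero_add, traceForm_comm] at this
    rw [ha0, hb0, add_zero]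
  have hc := (LinearMap.BilinForm.isCompl_orthogonal_iff_disjoint hr).2 hdisj
  have hxt : x ∈ (A ⊔ B) ⊔ (killingForm F V).orthogonal (A ⊔ B) := by
    rw [hc.sup_eq_top]; trivial
  obtain ⟨w, hw, c, hc, hwc⟩ := Submodule.mem_sup.1 hxt
  obtain ⟨a, ha, b, hb, rfl⟩ := Submodule.mem_sup.1 hw
  rw [LinearMap.BilinForm.mem_orthogonal_iff] at hc
  refine ⟨a, ha, x - a, sub_mem hx (h.left_le ha), fun b' hb' => ?_, by abel⟩
  have e : x - a = b + c := by rw [← hwc]; abel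
  have := hc b' (Submodule.mem_sup_right hb')
  rw [e, map_add, LinearMap.add_apply, hBB b hb b' hb', zero_add, traceForm_comm]
  exact this

variable [CharZero F] [IsKilling F V]

/-- Orthogonality makes `x` centralize degree `2` and `B`, and `h = ⁅x, f⁆` centralize `B` and,
dually, `A`. As `⁅h, x⁆ = 2x`, pairing `x` with `y` of degree `-1` reduces to terms `killingForm ⁅y,
b⁆ ⁅h, u⁆` with `u` of degree `2`. Both `⁅y, b⁆` and `u` lie in `ker (ad x)`, so these vanish. -/
theorem IsDualPair.eq_zero_of_mem_sup {A B : Submodule F V} (h : G.IsDualPair A B)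
    (hB : ∀ u ∈ G.piece (-3), ∀ v ∈ G.piece 2, ⁅u, v⁆ ∈ B) {x : V}
    (hx : x ∈ A ⊔ lieSpan₂ (G.piece 2) B)
    (hxB : ∀ y ∈ B ⊔ lieSpan₂ (G.piece (-2)) A, killingForm F V x y = 0) : x = 0 := by
  have hx1 : x ∈ G.piece 1 := by
    refine (sup_le h.left_le (lieSpan₂_le.2 fun u hu v hv => ?_) : _ ≤ G.piece 1) hx
    exact G.lie_mem_of_add_eq hu (h.right_le hv) (by norm_num)
  obtain ⟨f, hf1, hf⟩ := G.exists_lie_lie_eq hx1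
  have h0 : ⁅x, f⁆ ∈ G.piece 0 := G.lie_mem_of_add_eq hx1 hf1 (by norm_num)
  have h2 : ∀ v ∈ G.piece 2, ⁅x, v⁆ = 0 := fun v hv => by
    refine G.eq_zero_of_killingForm (j := -3) (by norm_num)
      (G.lie_mem_of_add_eq hx1 hv (by norm_num : (1 : ℤ) + 2 = 3)) fun w hw => ?_
    rw [killingForm_lie, ← lie_skew, map_neg,
      hxB _ (le_sup_left (b := lieSpan₂ (G.piece (-2)) A) (hB w hw v hv)), neg_zero]
  have hb : ∀ b ∈ B, ⁅x, b⁆ = 0 := fun b hb => by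
    refine G.eq_zero_of_killingForm (j := 0) (by norm_num)
      (G.lie_mem_of_add_eq hx1 (h.right_le hb) (by norm_num : (1 : ℤ) + -1 = 0)) fun w hw => ?_
    rw [killingForm_lie, ← lie_skew, map_neg,
      hxB _ (Submodule.mem_sup_left (h.lie_right w hw b hb)), neg_zero]
  -- The bracket lies in `B` because `⁅x, y⁆` has degree zero, so it is enough to pair it with `A`.
  have hyb : ∀ y ∈ G.piece (-1), ∀ b ∈ B, ⁅⁅x, y⁆, b⁆ = 0 := fun y hy b hbB => by
    have hxy : ⁅x, y⁆ ∈ G.piece 0 := G.lie_mem_of_add_eq hx1 hy (by norm_num)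
    refine h.separating_right _ (h.lie_right _ hxy b hbB) fun a ha => ?_
    rw [lie_lie, hb b hbB, lie_zero, sub_zero, killingForm_lie]
    refine hxB _ (Submodule.mem_sup_right (lie_mem_lieSpan₂ ?_ ha))
    exact G.lie_mem_of_add_eq hy (h.right_le hbB) (by norm_num)
  have hha : ∀ a ∈ A, ⁅⁅x, f⁆, a⁆ = 0 := fun a ha => by
    refine h.separating_left _ (h.lie_left _ h0 a ha) fun b hbB => ?_
    rw [killingForm_lie', hyb f hf1 b hbB, map_zero, neg_zero]
  refine G.eq_zero_of_killingForm (j := -1) (by norm_num) hx1 fun y hy => ?_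
  have hker : ∀ b ∈ B, ⁅x, ⁅y, b⁆⁆ = 0 := fun b hbB => by
    have := hyb y hy b hbB
    rwa [lie_lie, hb b hbB, lie_zero, sub_zero] at this
  have hzero : ∀ w ∈ A ⊔ lieSpan₂ (G.piece 2) B, killingForm F V y ⁅⁅x, f⁆, w⁆ = 0 := by
    have hle : A ⊔ lieSpan₂ (G.piece 2) B ≤
        LinearMap.ker ((killingForm F V y).comp (ad F V ⁅x, f⁆)) := by
      refine sup_le (fun a ha => ?_) (lieSpan₂_le.2 fun u hu b hbB => ?_)
      · rw [LinearMap.mem_ker, LinearMap.comp_apply, ad_apply, hha a ha, map_zero]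
      · rw [LinearMap.mem_ker, LinearMap.comp_apply, ad_apply, leibniz_lie, hyb f hf1 b hbB,
          lie_zero, add_zero, ← lie_skew, map_neg, ← killingForm_lie, neg_eq_zero]
        exact killingForm_lie_eq_zero_of_mem_natEigenspaces
          (G.mem_natEigenspaces_of_lie_eq_zero hx1 hf (hker b hbB))
          (G.mem_natEigenspaces_of_lie_eq_zero hx1 hf (h2 u hu))
    exact fun w hw => hle hw
  have := hzero x hx
  rw [hf, map_smul, smul_eq_mul, mul_eq_zero, traceForm_comm] at this
  exact this.resolve_left two_ne_zero

/-- A dual pair containing the brackets of degrees `(3, -2)` and `(-3, 2)` can be enlarged. -/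
theorem IsDualPair.sup {A B : Submodule F V} (h : G.IsDualPair A B)
    (hA : ∀ u ∈ G.piece 3, ∀ v ∈ G.piece (-2), ⁅u, v⁆ ∈ A)
    (hB : ∀ u ∈ G.piece (-3), ∀ v ∈ G.piece 2, ⁅u, v⁆ ∈ B) :
    G.IsDualPair (A ⊔ lieSpan₂ (G.piece 2) B) (B ⊔ lieSpan₂ (G.piece (-2)) A) := by
  have hlie : ∀ {S T U : Submodule F V}, (∀ z ∈ G.piece 0, ∀ a ∈ U, ⁅z, a⁆ ∈ U) →
      (∀ z ∈ G.piece 0, ∀ a ∈ S, ⁅z, a⁆ ∈ S) → (∀ z ∈ G.piece 0, ∀ a ∈ T, ⁅z, a⁆ ∈ T) →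
      ∀ z ∈ G.piece 0, ∀ a ∈ U ⊔ lieSpan₂ S T, ⁅z, a⁆ ∈ U ⊔ lieSpan₂ S T := by
    intro S T U hU hS hT z hz a ha
    have : U ⊔ lieSpan₂ S T ≤ (U ⊔ lieSpan₂ S T).comap (ad F V z) := by
      refine sup_le (fun u hu => Submodule.mem_sup_left (hU z hz u hu))
        (lieSpan₂_le.2 fun s hs t ht => Submodule.mem_sup_right ?_)
      rw [ad_apply, leibniz_lie]
      exact add_mem (lie_mem_lieSpan₂ (hS z hz s hs) ht) (lie_mem_lieSpan₂ hs (hT z hz t ht))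
    exact this ha
  have hp : ∀ k, ∀ z ∈ G.piece 0, ∀ a ∈ G.piece k, ⁅z, a⁆ ∈ G.piece k :=
    fun k z hz a ha => G.lie_mem_of_add_eq hz ha (by ring)
  refine ⟨?_, ?_, hlie h.lie_left (hp 2) h.lie_right,
    hlie h.lie_right (hp (-2)) h.lie_left, fun a ha => h.eq_zero_of_mem_sup hB ha,
    fun b hb hb' => ?_⟩
  · refine sup_le h.left_le (lieSpan₂_le.2 fun u hu v hv => ?_)
    exact G.lie_mem_of_add_eq hu (h.right_le hv) (by norm_num)
  · refine sup_le h.right_le (lieSpan₂_le.2 fun u hu v hv => ?_)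
    exact G.lie_mem_of_add_eq hu (h.left_le hv) (by norm_num)
  · exact h.rev.eq_zero_of_mem_sup (by simpa using hA) hb (by simpa using hb')

end LieGrading

/-! ### Maximal dual pairs and generation of degrees `1` and `-1`. -/

namespace LieGrading

open LieAlgebra LieModule

variable {F V : Type*} [Field F] [LieRing V] [LieAlgebra F V]

section

variable {G : LieGrading F V} [CharZero F] [Module.Finite F V] [IsKilling F V]

/-- The brackets of degrees `(3, -2)` and `(-3, 2)` form a dual pair. -/
theorem isDualPair_lieSpan₂ :
    G.IsDualPair (lieSpan₂ (G.piece 3) (G.piece (-2))) (lieSpan₂ (G.piece (-3)) (G.piece 2)) := by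
  have hlie : ∀ k l : ℤ, ∀ z ∈ G.piece 0, ∀ a ∈ lieSpan₂ (G.piece k) (G.piece l),
      ⁅z, a⁆ ∈ lieSpan₂ (G.piece k) (G.piece l) := by
    intro k l z hz a ha
    have : lieSpan₂ (G.piece k) (G.piece l) ≤
        (lieSpan₂ (G.piece k) (G.piece l)).comap (ad F V z) := by
      refine lieSpan₂_le.2 fun s hs t ht => ?_
      rw [Submodule.mem_comap, ad_apply, leibniz_lie]
      exact add_mem (lie_mem_lieSpan₂ (G.lie_mem_of_add_eq hz hs (zero_add k)) ht)
        (lie_mem_lieSpan₂ hs (G.lie_mem_of_add_eq hz ht (zero_add l)))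
    exact this ha
  refine ⟨?_, ?_, hlie 3 (-2), hlie (-3) 2, fun a ha h => G.eq_zero_of_mem_lieSpan₂ ha h,
    fun b hb h => G.rev.eq_zero_of_mem_lieSpan₂ (by simpa using hb) (by simpa using h)⟩
  · exact lieSpan₂_le.2 fun u hu v hv => G.lie_mem_of_add_eq hu hv (by norm_num)
  · exact lieSpan₂_le.2 fun u hu v hv => G.lie_mem_of_add_eq hu hv (by norm_num)

/-- Finite dimension provides a maximal pair inside `O` above the initial one; since the enlargement
by degrees `±2` stays in `O`, it must be trivial. -/
theorem exists_maximal_isDualPair (O : LieSubalgebra F V)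
    (hO : ∀ k : ℤ, 2 ≤ k → G.piece k ≤ O.toSubmodule ∧ G.piece (-k) ≤ O.toSubmodule) :
    ∃ A B : Submodule F V, G.IsDualPair A B ∧ A ≤ O.toSubmodule ∧ B ≤ O.toSubmodule ∧
      lieSpan₂ (G.piece 2) B ≤ A ∧ lieSpan₂ (G.piece (-2)) A ≤ B ∧
      lieSpan₂ (G.piece (-3)) (G.piece 2) ≤ B := by
  let S : Set (Submodule F V × Submodule F V) :=
    {p | G.IsDualPair p.1 p.2 ∧ p.1 ≤ O.toSubmodule ∧ p.2 ≤ O.toSubmodule ∧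
      lieSpan₂ (G.piece 3) (G.piece (-2)) ≤ p.1 ∧ lieSpan₂ (G.piece (-3)) (G.piece 2) ≤ p.2}
  have hle : ∀ {X Y : Submodule F V}, X ≤ O.toSubmodule → Y ≤ O.toSubmodule →
      lieSpan₂ X Y ≤ O.toSubmodule :=
    fun hX hY => lieSpan₂_le.2 fun u hu v hv => O.lie_mem (hX hu) (hY hv)
  have hne : S.Nonempty :=
    ⟨(lieSpan₂ (G.piece 3) (G.piece (-2)), lieSpan₂ (G.piece (-3)) (G.piece 2)),
      isDualPair_lieSpan₂, hle (hO 3 (by norm_num)).1 (hO 2 le_rfl).2,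
      hle (hO 3 (by norm_num)).2 (hO 2 le_rfl).1, le_rfl, le_rfl⟩
  obtain ⟨⟨A, B⟩, ⟨hAB, hA, hB, hA', hB'⟩, hmax⟩ :=
    (wellFounded_gt (α := Submodule F V × Submodule F V)).has_min S hne
  have hsup := hAB.sup (lieSpan₂_le.1 hA') (lieSpan₂_le.1 hB')
  have hnot := hmax (A ⊔ lieSpan₂ (G.piece 2) B, B ⊔ lieSpan₂ (G.piece (-2)) A)
    ⟨hsup, sup_le hA (hle (hO 2 le_rfl).1 hB), sup_le hB (hle (hO 2 le_rfl).2 hA),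
      hA'.trans le_sup_left, hB'.trans le_sup_left⟩
  have hge : ((A, B) : Submodule F V × Submodule F V) ≤
    (A ⊔ lieSpan₂ (G.piece 2) B, B ⊔ lieSpan₂ (G.piece (-2)) A) := ⟨le_sup_left, le_sup_left⟩
  have heq := eq_of_le_of_not_lt hge hnot
  refine ⟨A, B, hAB, hA, hB, ?_, ?_, hB'⟩
  · exact le_sup_right.trans (congrArg Prod.fst heq).ge
  · exact le_sup_right.trans (congrArg Prod.snd heq).ge

/-- If the centralizer of degree one elements has no homogeneous elements of degrees one and two,
then the pieces of degree at least two in absolute value generate those of degrees `±1`. -/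
theorem piece_le_of_outer_le (h1 : ∀ z ∈ G.piece 1, (∀ y ∈ G.piece 1, ⁅y, z⁆ = 0) → z = 0)
    (h2 : ∀ z ∈ G.piece 2, (∀ y ∈ G.piece 1, ⁅y, z⁆ = 0) → z = 0) (O : LieSubalgebra F V)
    (hO : ∀ k : ℤ, 2 ≤ k → G.piece k ≤ O.toSubmodule ∧ G.piece (-k) ≤ O.toSubmodule) :
    G.piece 1 ≤ O.toSubmodule ∧ G.piece (-1) ≤ O.toSubmodule := by
  obtain ⟨A, B, hAB, hA, hB, hA2, hB2, hB3⟩ := exists_maximal_isDualPair O hO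
  have hc2 : ∀ c ∈ G.piece 1, (∀ b ∈ B, killingForm F V c b = 0) → ∀ v ∈ G.piece 2, ⁅c, v⁆ = 0 := by
    intro c hc hcB v hv
    refine G.eq_zero_of_killingForm (j := -3) (by norm_num)
      (G.lie_mem_of_add_eq hc hv (by norm_num : (1 : ℤ) + 2 = 3)) fun w hw => ?_
    rw [killingForm_lie, ← lie_skew, map_neg, hcB _ (hB3 (lie_mem_lieSpan₂ hw hv)), neg_zero]
  have hcA : ∀ c ∈ G.piece 1, (∀ b ∈ B, killingForm F V c b = 0) → ∀ a ∈ A, ⁅c, a⁆ = 0 := by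
    intro c hc hcB a ha
    refine G.eq_zero_of_killingForm (j := -2) (by norm_num)
      (G.lie_mem_of_add_eq hc (hAB.left_le ha) (by norm_num : (1 : ℤ) + 1 = 2)) fun w hw => ?_
    rw [killingForm_lie, ← lie_skew, map_neg, hcB _ (hB2 (lie_mem_lieSpan₂ hw ha)), neg_zero]
  -- `⁅c, d⁆` has degree two and, by Jacobi, commutes with degree one, because `c` and `d`
  -- annihilate degree two; so `h2` applies.
  have hcc : ∀ c ∈ G.piece 1, (∀ b ∈ B, killingForm F V c b = 0) →
      ∀ d ∈ G.piece 1, (∀ b ∈ B, killingForm F V d b = 0) → ⁅c, d⁆ = 0 := by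
    intro c hc hcB d hd hdB
    refine h2 _ (G.lie_mem_of_add_eq hc hd (by norm_num)) fun y hy => ?_
    rw [leibniz_lie, ← lie_skew ⁅y, c⁆ d, hc2 d hd hdB _ (G.lie_mem_of_add_eq hy hc (by norm_num)),
      hc2 c hc hcB _ (G.lie_mem_of_add_eq hy hd (by norm_num)), neg_zero, add_zero]
  have hc0 : ∀ c ∈ G.piece 1, (∀ b ∈ B, killingForm F V c b = 0) → c = 0 := by
    intro c hc hcB
    refine h1 c hc fun y hy => ?_
    obtain ⟨a, ha, d, hd, hdB, rfl⟩ := exists_add_of_isDualPair hAB hy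
    rw [add_lie, ← lie_skew a c, hcA c hc hcB a ha, hcc d hd hdB c hc hcB, neg_zero, add_zero]
  have h1A : G.piece 1 ≤ A := fun x hx => by
    obtain ⟨a, ha, d, hd, hdB, rfl⟩ := exists_add_of_isDualPair hAB hx
    rw [hc0 d hd hdB, add_zero]; exact ha
  refine ⟨h1A.trans hA, fun x hx => ?_⟩
  obtain ⟨b, hb, d, hd, hdA, rfl⟩ := exists_add_of_isDualPair hAB.rev (x := x) (by simpa using hx)
  have hd0 : d = 0 := G.eq_zero_of_killingForm (i := -1) (j := 1) (by norm_num)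
    (by simpa using hd) fun y hy => hdA y (h1A hy)
  rw [hd0, add_zero]
  exact hB hb

end

/-! ### Ideals arising from elements that centralize the positive part. -/

variable (G : LieGrading F V)

/-- The elements obtained from `z` and the degree zero centralizing elements by applying lowering
operators, recorded with their degree. -/
inductive Lowering (k : ℤ) : ℤ → V → Prop
  | base {w : V} (hw : w ∈ G.piece k) (h : ∀ j > 0, ∀ y ∈ G.piece j, ⁅y, w⁆ = 0) : Lowering k k w
  | step {i j : ℤ} {u w : V} (hi : i < 0) (hu : u ∈ G.piece i) (hw : Lowering k j w) :
      Lowering k (i + j) ⁅u, w⁆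

theorem Lowering.mem {G : LieGrading F V} {k j : ℤ} {w : V} (h : G.Lowering k j w) :
    w ∈ G.piece j := by
  induction h with
  | base hw _ => exact hw
  | step _ hu _ ih => exact G.lie_mem hu ih

theorem Lowering.le {G : LieGrading F V} {k j : ℤ} {w : V} (h : G.Lowering k j w) : j ≤ k := by
  induction h with
  | base _ _ => exact le_rfl
  | step hi _ _ ih => omega

/-- Positive degrees kill base vectors and degree zero preserves the base condition, which is why
all centralizing vectors of degree `k` are admitted. For a step, Jacobi moves `y` past the lowering
element. -/
theorem Lowering.lie_mem_span {G : LieGrading F V} {k j : ℤ} {w : V} (h : G.Lowering k j w)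
    (y : V) : ⁅y, w⁆ ∈ Submodule.span F {w | ∃ j, G.Lowering k j w} := by
  induction h generalizing y with
  | @base w hw h =>
    have hy : y ∈ ⨆ i, G.piece i := by rw [G.iSup_piece]; trivial
    induction hy using Submodule.iSup_induction' with
    | mem i y hy =>
      rcases lt_trichotomy i 0 with hi | rfl | hi
      · exact Submodule.subset_span ⟨_, .step hi hy (.base hw h)⟩
      · refine Submodule.subset_span ⟨k, .base (G.lie_mem_of_add_eq hy hw (zero_add k)) ?_⟩
        intro j hj v hv
        rw [leibniz_lie, h j hj v hv, lie_zero, add_zero]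
        exact h j hj _ (G.lie_mem_of_add_eq hv hy (add_zero j))
      · rw [h i hi y hy]; exact zero_mem _
    | zero => rw [zero_lie]; exact zero_mem _
    | add a b _ _ ha hb => rw [add_lie]; exact add_mem ha hb
  | @step i j u w hi hu hw ih =>
    rw [leibniz_lie]
    refine add_mem (ih _) ?_
    have hle : Submodule.span F {w | ∃ j, G.Lowering k j w} ≤
        (Submodule.span F {w | ∃ j, G.Lowering k j w}).comap (ad F V u) := by
      refine Submodule.span_le.2 ?_
      rintro v ⟨l, hv⟩
      exact Submodule.subset_span ⟨_, .step hi hu hv⟩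
    exact hle (ih y)

/-- The ideal generated by the elements of degree `k` centralizing the positive part. -/
def loweringIdeal (k : ℤ) : LieIdeal F V where
  toSubmodule := Submodule.span F {w | ∃ j, G.Lowering k j w}
  lie_mem {y w} hw := by
    have hle : Submodule.span F {w | ∃ j, G.Lowering k j w} ≤
        (Submodule.span F {w | ∃ j, G.Lowering k j w}).comap (ad F V y) := by
      refine Submodule.span_le.2 ?_
      rintro v ⟨l, hv⟩
      exact hv.lie_mem_span y
    exact hle hw

theorem mem_loweringIdeal {k : ℤ} {z : V} (hz : z ∈ G.piece k)
    (h : ∀ j > 0, ∀ y ∈ G.piece j, ⁅y, z⁆ = 0) : z ∈ G.loweringIdeal k :=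
  Submodule.subset_span ⟨k, .base hz h⟩

/-- The generators have degree at most `k`, so one of degree below `-k` is Killing-orthogonal to the
whole ideal and lies in its intersection with its Killing complement, which is zero. -/
theorem loweringIdeal_le [Module.Finite F V] [IsKilling F V] (k : ℤ) :
    (G.loweringIdeal k).toSubmodule ≤ ⨆ j, ⨆ _ : |j| ≤ k, G.piece j := by
  refine Submodule.span_le.2 ?_
  rintro w ⟨j, hw⟩
  by_cases hj : |j| ≤ k
  · exact Submodule.mem_iSup_of_mem j (Submodule.mem_iSup_of_mem hj hw.mem)
  · have hjk := hw.le
    have hj' : j < -k := by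
      by_contra h
      exact hj (abs_le.2 ⟨by omega, hjk⟩)
    have hw' : w ∈ (G.loweringIdeal k).killingCompl := by
      rw [LieIdeal.mem_killingCompl]
      have hle : Submodule.span F {w | ∃ j, G.Lowering k j w} ≤
          LinearMap.ker ((killingForm F V).flip w) := by
        refine Submodule.span_le.2 ?_
        rintro v ⟨l, hv⟩
        have := hv.le
        exact G.killingForm_eq_zero (by omega) hv.mem hw.mem
      exact fun y hy => hle hy
    have hmem : w ∈ G.loweringIdeal k := Submodule.subset_span ⟨j, hw⟩
    have hinf : w ∈ G.loweringIdeal k ⊓ (G.loweringIdeal k).killingCompl := ⟨hmem, hw'⟩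
    rw [(G.loweringIdeal k).isCompl_killingCompl.inf_eq_bot] at hinf
    rw [(LieSubmodule.mem_bot w).1 hinf]
    exact zero_mem _

end LieGrading

/-- The Killing property is preserved by extension of scalars. -/
theorem LieAlgebra.isKilling_baseChange (K A L : Type*) [Field K] [Field A] [Algebra K A]
    [LieRing L] [LieAlgebra K L] [Module.Finite K L] [LieAlgebra.IsKilling K L] :
    LieAlgebra.IsKilling A (A ⊗[K] L) := by
  let b := Module.finBasis K L
  have h := LieAlgebra.IsKilling.killingForm_nondegenerate K L
  rw [LinearMap.BilinForm.nondegenerate_iff_det_ne_zero b] at h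
  have h' : (killingForm A (A ⊗[K] L)).Nondegenerate := by
    rw [LinearMap.BilinForm.nondegenerate_iff_det_ne_zero (b.baseChange A)]
    have e : LinearMap.BilinForm.toMatrix (b.baseChange A) (killingForm A (A ⊗[K] L)) =
        (LinearMap.BilinForm.toMatrix b (killingForm K L)).map (algebraMap K A) := by
      ext i j
      have hk : killingForm A (A ⊗[K] L) = LinearMap.BilinForm.baseChange A (killingForm K L) :=
        LieModule.traceForm_baseChange K L L A
      rw [LinearMap.BilinForm.toMatrix_apply, Matrix.map_apply,
        LinearMap.BilinForm.toMatrix_apply, hk]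
      simp [Algebra.algebraMap_eq_smul_one]
    rw [e, ← RingHom.mapMatrix_apply, ← RingHom.map_det]
    simpa using h
  constructor
  rw [LieSubmodule.eq_bot_iff]
  intro x hx
  exact h'.2 x fun y => LieIdeal.mem_killingCompl A (A ⊗[K] L) ⊤ |>.1 hx y (LieSubmodule.mem_top y)

/-! ### Complex conjugation, real ideals and the level. -/

namespace HodgeLie

variable {K : Type*} [Field K] [Algebra K ℝ] {L : Type*} [LieRing L] [LieAlgebra K L]

@[simp] theorem conj_tmul (c : ℂ) (x : L) :
    conj K L (c ⊗ₜ[K] x) = (starRingEnd ℂ c) ⊗ₜ[K] x := rfl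

@[simp] theorem realToComplex_tmul (r : ℝ) (x : L) :
    realToComplex K L (r ⊗ₜ[K] x) = (r : ℂ) ⊗ₜ[K] x := rfl

theorem conj_conj (x : ℂ ⊗[K] L) : conj K L (conj K L x) = x := by
  induction x using TensorProduct.induction_on with
  | zero => simp
  | tmul c x => simp
  | add x y hx hy => rw [map_add, map_add, hx, hy]

theorem conj_smul (c : ℂ) (x : ℂ ⊗[K] L) :
    conj K L (c • x) = (starRingEnd ℂ c) • conj K L x := by
  induction x using TensorProduct.induction_on with
  | zero => simp
  | tmul d x => simp [TensorProduct.smul_tmul']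
  | add x y hx hy => rw [smul_add, map_add, map_add, hx, hy, smul_add]

theorem conj_lie (x y : ℂ ⊗[K] L) : conj K L ⁅x, y⁆ = ⁅conj K L x, conj K L y⁆ := by
  induction x using TensorProduct.induction_on with
  | zero => simp
  | tmul c x =>
    induction y using TensorProduct.induction_on with
    | zero => simp
    | tmul d y => simp
    | add y z hy hz => rw [lie_add, map_add, map_add, lie_add, hy, hz]
  | add x z hx hz => rw [add_lie, map_add, map_add, add_lie, hx, hz]

theorem realToComplex_lie (x y : ℝ ⊗[K] L) :
    realToComplex K L ⁅x, y⁆ = ⁅realToComplex K L x, realToComplex K L y⁆ := by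
  induction x using TensorProduct.induction_on with
  | zero => simp
  | tmul c x =>
    induction y using TensorProduct.induction_on with
    | zero => simp
    | tmul d y => simp
    | add y z hy hz => rw [lie_add, map_add, map_add, lie_add, hy, hz]
  | add x z hx hz => rw [add_lie, map_add, map_add, add_lie, hx, hz]

theorem realToComplex_smul (r : ℝ) (x : ℝ ⊗[K] L) :
    realToComplex K L (r • x) = (r : ℂ) • realToComplex K L x := by
  induction x using TensorProduct.induction_on with
  | zero => simp
  | tmul d x => simp [TensorProduct.smul_tmul']
  | add x y hx hy => rw [smul_add, map_add, map_add, hx, hy, smul_add]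

theorem conj_realToComplex (x : ℝ ⊗[K] L) :
    conj K L (realToComplex K L x) = realToComplex K L x := by
  induction x using TensorProduct.induction_on with
  | zero => simp
  | tmul d x => simp
  | add x y hx hy => rw [map_add, map_add, hx, hy]

theorem exists_realToComplex_eq_add_conj (z : ℂ ⊗[K] L) :
    ∃ x, realToComplex K L x = z + conj K L z := by
  induction z using TensorProduct.induction_on with
  | zero => exact ⟨0, by simp⟩
  | tmul c x =>
    refine ⟨(2 * c.re) ⊗ₜ[K] x, ?_⟩
    rw [realToComplex_tmul, conj_tmul, ← TensorProduct.add_tmul, Complex.add_conj]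
  | add y z hy hz =>
    obtain ⟨a, ha⟩ := hy
    obtain ⟨b, hb⟩ := hz
    exact ⟨a + b, by rw [map_add, ha, hb, map_add]; abel⟩

/-- The ideal of `L_ℝ` of real points of the sum of an ideal of `L_ℂ` and its conjugate. -/
def realIdeal (J : LieIdeal ℂ (ℂ ⊗[K] L)) : LieIdeal ℝ (ℝ ⊗[K] L) where
  carrier := {x | ∃ a ∈ J, ∃ b ∈ J, realToComplex K L x = a + conj K L b}
  zero_mem' := ⟨0, zero_mem _, 0, zero_mem _, by simp⟩
  add_mem' := by
    rintro x y ⟨a, ha, b, hb, hx⟩ ⟨c, hc, d, hd, hy⟩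
    exact ⟨a + c, add_mem ha hc, b + d, add_mem hb hd, by rw [map_add, hx, hy, map_add]; abel⟩
  smul_mem' := by
    rintro r x ⟨a, ha, b, hb, hx⟩
    refine ⟨(r : ℂ) • a, J.smul_mem _ ha, (r : ℂ) • b, J.smul_mem _ hb, ?_⟩
    rw [realToComplex_smul, hx, smul_add, conj_smul, Complex.conj_ofReal]
  lie_mem := by
    rintro y x ⟨a, ha, b, hb, hx⟩
    refine ⟨⁅realToComplex K L y, a⁆, J.lie_mem ha, ⁅realToComplex K L y, b⁆, J.lie_mem hb, ?_⟩
    rw [realToComplex_lie, hx, lie_add, conj_lie, conj_realToComplex]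

theorem realIdeal_ne_bot {J : LieIdeal ℂ (ℂ ⊗[K] L)} (hJ : J ≠ ⊥) : realIdeal J ≠ ⊥ := by
  intro h
  apply hJ
  rw [LieSubmodule.eq_bot_iff]
  have key : ∀ z ∈ J, z + conj K L z = 0 := by
    intro z hz
    obtain ⟨x, hx⟩ := exists_realToComplex_eq_add_conj z
    have hmem : x ∈ realIdeal J := ⟨z, hz, z, hz, hx⟩
    rw [h, LieSubmodule.mem_bot] at hmem
    rw [← hx, hmem, map_zero]
  intro z hz
  have h1 := key z hz
  -- Conjugation is `-1` on both `z` and `I • z`, yet antilinear; hence `2 * I • z = 0`.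
  have h2 := key (Complex.I • z) (J.smul_mem _ hz)
  rw [conj_smul, Complex.conj_I, eq_neg_of_add_eq_zero_right h1, smul_neg, neg_smul, neg_neg,
    ← two_smul ℂ, smul_smul] at h2
  exact (smul_eq_zero.1 h2).resolve_left (by simp)

namespace HodgeStructure

variable (φ : HodgeStructure K L)

/-- The grading of the complexification underlying a Hodge structure. -/
def grading : LieGrading ℂ (ℂ ⊗[K] L) where
  piece := φ.piece
  isInternal := φ.isInternal
  lie_mem {i j x y} := φ.lie_mem i j x y

@[simp] theorem grading_piece (k : ℤ) : φ.grading.piece k = φ.piece k := rfl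

theorem conj_mem_iSup {k : ℤ} {x : ℂ ⊗[K] L}
    (hx : x ∈ ⨆ j, ⨆ _ : |j| ≤ k, φ.piece j) : conj K L x ∈ ⨆ j, ⨆ _ : |j| ≤ k, φ.piece j := by
  rw [iSup_subtype'] at hx
  induction hx using Submodule.iSup_induction' with
  | mem j x hx =>
    refine Submodule.mem_iSup_of_mem (-j.1) (Submodule.mem_iSup_of_mem ?_ (φ.conj_mem _ _ hx))
    rw [abs_neg]; exact j.2
  | zero => rw [map_zero]; exact zero_mem _
  | add a b _ _ ha hb => rw [map_add]; exact add_mem ha hb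

/-- Real simple ideals have nonzero pieces in degrees at least the level. -/
theorem exists_piece_ne_bot {I : LieIdeal ℝ (ℝ ⊗[K] L)} (hI : LieAlgebra.IsSimple ℝ I) {n : ℕ}
    (hn : 0 < n) (h : n ≤ φ.level) :
    ∃ m : ℕ, n ≤ m ∧ complexify I ⊓ φ.piece (m : ℤ) ≠ ⊥ := by
  have hle : n ≤ φ.idealLevel I := h.trans (Nat.sInf_le ⟨I, hI, rfl⟩)
  -- An empty or unbounded set of naturals has `sSup` equal to `0`, which `0 < n` excludes; the
  -- supremum is therefore attained.
  have hne : {k : ℕ | complexify I ⊓ φ.piece (k : ℤ) ≠ ⊥}.Nonempty := by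
    by_contra hemp
    rw [Set.not_nonempty_iff_eq_empty] at hemp
    rw [idealLevel, hemp, csSup_empty] at hle
    exact absurd hle (by simpa using hn.ne')
  have hbdd : BddAbove {k : ℕ | complexify I ⊓ φ.piece (k : ℤ) ≠ ⊥} := by
    by_contra hb
    rw [idealLevel, Nat.sSup_of_not_bddAbove hb] at hle
    omega
  exact ⟨φ.idealLevel I, hle, Nat.sSup_mem hne hbdd⟩

variable [Module.Finite K L] [LieAlgebra.IsSemisimple K L]

theorem isKilling_tensorProduct (A : Type*) [Field A] [Algebra K A] :
    LieAlgebra.IsKilling A (A ⊗[K] L) := by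
  have : CharZero K := (algebraMap K ℝ).charZero
  exact LieAlgebra.isKilling_baseChange K A L

/-- A nonzero `z` would lie in an ideal concentrated in degrees `|j| ≤ k`. The real points of that
ideal plus its conjugate contain a simple factor, which then has nothing in degrees `≥ 3`. -/
theorem eq_zero_of_forall_lie_eq_zero (hlevel : 3 ≤ φ.level) {k : ℤ} (hk : k < 3) {z : ℂ ⊗[K] L} (hz : z ∈ φ.piece k)
    (h : ∀ j > 0, ∀ y ∈ φ.piece j, ⁅y, z⁆ = 0) : z = 0 := by
  have := isKilling_tensorProduct (K := K) (L := L) ℂ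
  have := isKilling_tensorProduct (K := K) (L := L) ℝ
  by_contra hz0
  have hmem := φ.grading.mem_loweringIdeal hz h
  have hJ : φ.grading.loweringIdeal k ≠ ⊥ := by
    intro hbot
    rw [hbot, LieSubmodule.mem_bot] at hmem
    exact hz0 hmem
  obtain ⟨S, hS, hSJ⟩ := (IsAtomic.eq_bot_or_exists_atom_le
    (realIdeal (φ.grading.loweringIdeal k))).resolve_left (realIdeal_ne_bot hJ)
  obtain ⟨m, hm, hne⟩ :=
    φ.exists_piece_ne_bot (LieAlgebra.IsSemisimple.isSimple_of_isAtom S hS) (by norm_num) hlevel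
  apply hne
  rw [Submodule.eq_bot_iff]
  rintro w ⟨hw, hwm⟩
  have hle : complexify S ≤ ⨆ j, ⨆ _ : |j| ≤ k, φ.piece j := by
    refine Submodule.span_le.2 ?_
    rintro _ ⟨x, hx, rfl⟩
    obtain ⟨a, ha, b, hb, hab⟩ := hSJ hx
    rw [SetLike.mem_coe, hab]
    exact add_mem (φ.grading.loweringIdeal_le k ha)
      (φ.conj_mem_iSup (φ.grading.loweringIdeal_le k hb))
  refine φ.grading.eq_zero_of_mem_of_mem_iSup (P := fun j => |j| ≤ k) ?_ hwm (hle hw)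
  rw [Nat.abs_cast]; omega

end HodgeStructure
end HodgeLie

/-! ### Application to Hodge structures generated in degree one. -/

namespace HodgeLie

variable {K : Type*} [Field K] [Algebra K ℝ] {L : Type*} [LieRing L] [LieAlgebra K L]

/-- The complexification of a subalgebra, as a subalgebra. -/
def complexSubalgebra (H : LieSubalgebra K L) : LieSubalgebra ℂ (ℂ ⊗[K] L) where
  toSubmodule := H.toSubmodule.baseChange ℂ
  lie_mem' {x y} hx hy := by
    change x ∈ H.toSubmodule.baseChange ℂ at hx
    change y ∈ H.toSubmodule.baseChange ℂ at hy
    change ⁅x, y⁆ ∈ H.toSubmodule.baseChange ℂ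
    rw [Submodule.baseChange_eq_span] at hx hy
    induction hx using Submodule.span_induction with
    | mem x hx =>
      obtain ⟨a, ha, rfl⟩ := hx
      induction hy using Submodule.span_induction with
      | mem y hy =>
        obtain ⟨b, hb, rfl⟩ := hy
        exact Submodule.tmul_mem_baseChange_of_mem (1 * 1 : ℂ) (H.lie_mem ha hb)
      | zero => rw [lie_zero]; exact zero_mem _
      | add y z _ _ hy hz => rw [lie_add]; exact add_mem hy hz
      | smul c y _ hy => rw [lie_smul]; exact Submodule.smul_mem _ c hy
    | zero => rw [zero_lie]; exact zero_mem _
    | add x z _ _ hx hz => rw [add_lie]; exact add_mem hx hz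
    | smul c x _ hx => rw [smul_lie]; exact Submodule.smul_mem _ c hx

theorem conj_mem_baseChange {M : Submodule K L} {x : ℂ ⊗[K] L} (hx : x ∈ M.baseChange ℂ) :
    conj K L x ∈ M.baseChange ℂ := by
  rw [Submodule.baseChange_eq_span] at hx
  induction hx using Submodule.span_induction with
  | mem x hx =>
    obtain ⟨a, ha, rfl⟩ := hx
    exact Submodule.tmul_mem_baseChange_of_mem _ ha
  | zero => rw [map_zero]; exact zero_mem _
  | add x z _ _ hx hz => rw [map_add]; exact add_mem hx hz
  | smul c x _ hx => rw [conj_smul]; exact Submodule.smul_mem _ _ hx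

namespace HodgeStructure

variable {φ : HodgeStructure K L}

/-- An element commuting with `L^1` commutes with `L^+`. -/
theorem OneGeneratesPlus.lie_eq_zero (hgen : φ.OneGeneratesPlus) {z : ℂ ⊗[K] L}
    (hz : ∀ y ∈ φ.piece 1, ⁅y, z⁆ = 0) : ∀ j > 0, ∀ y ∈ φ.piece j, ⁅y, z⁆ = 0 := by
  let C : LieSubalgebra ℂ (ℂ ⊗[K] L) :=
    { carrier := {y | ⁅y, z⁆ = 0}
      zero_mem' := zero_lie z
      add_mem' := fun {a b} (ha : ⁅a, z⁆ = 0) (hb : ⁅b, z⁆ = 0) => by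
        rw [Set.mem_ofPred_eq, add_lie, ha, hb, add_zero]
      smul_mem' := fun c a (ha : ⁅a, z⁆ = 0) => by
        rw [Set.mem_ofPred_eq, smul_lie, ha, smul_zero]
      lie_mem' := fun {a b} (ha : ⁅a, z⁆ = 0) (hb : ⁅b, z⁆ = 0) => by
        change ⁅⁅a, b⁆, z⁆ = 0
        rw [lie_lie, ha, hb, lie_zero, lie_zero, sub_zero] }
  have hC : LieSubalgebra.lieSpan ℂ (ℂ ⊗[K] L) (φ.piece 1 : Set (ℂ ⊗[K] L)) ≤ C :=
    LieSubalgebra.lieSpan_le.2 hz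
  intro j hj y hy
  have hy' : y ∈ φ.plus := Submodule.mem_iSup_of_mem j (Submodule.mem_iSup_of_mem hj hy)
  rw [← hgen] at hy'
  exact hC hy'

variable [Module.Finite K L] [LieAlgebra.IsSemisimple K L]

/-- A subalgebra of `L_ℂ` containing all pieces of degree `|k| ≥ 2` contains `L^{±1}`. -/
theorem piece_one_le (hgen : φ.OneGeneratesPlus) (hlevel : 3 ≤ φ.level)
    (O : LieSubalgebra ℂ (ℂ ⊗[K] L))
    (hO : ∀ k : ℤ, 2 ≤ k → φ.piece k ≤ O.toSubmodule ∧ φ.piece (-k) ≤ O.toSubmodule) :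
    φ.piece 1 ≤ O.toSubmodule ∧ φ.piece (-1) ≤ O.toSubmodule := by
  have := isKilling_tensorProduct (K := K) (L := L) ℂ
  exact LieGrading.piece_le_of_outer_le (G := φ.grading)
    (fun z hz h => φ.eq_zero_of_forall_lie_eq_zero hlevel (by norm_num) hz (hgen.lie_eq_zero h))
    (fun z hz h => φ.eq_zero_of_forall_lie_eq_zero hlevel (by norm_num) hz (hgen.lie_eq_zero h))
    O hO

/-- Otherwise conjugation and Killing duality make `L^1` commute with `L^2`. Then `L^2` centralizes
`L^+` and vanishes, hence so does `L^1`, and `L^+ = 0` contradicts the level. -/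
theorem exists_lie_ne_zero (hgen : φ.OneGeneratesPlus) (hlevel : 3 ≤ φ.level) :
    ∃ x ∈ φ.piece (-2), ∃ y ∈ φ.piece 3, ⁅x, y⁆ ≠ 0 := by
  have := isKilling_tensorProduct (K := K) (L := L) ℂ
  by_contra! h
  have hconj : ∀ b ∈ φ.piece 2, ∀ w ∈ φ.piece (-3), ⁅b, w⁆ = 0 := by
    intro b hb w hw
    rw [← conj_conj ⁅b, w⁆, conj_lie, h _ (φ.conj_mem 2 b hb) _ (φ.conj_mem (-3) w hw), map_zero]
  have h12 : ∀ a ∈ φ.piece 1, ∀ b ∈ φ.piece 2, ⁅a, b⁆ = 0 := by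
    intro a ha b hb
    refine φ.grading.eq_zero_of_killingForm (i := 3) (j := -3) (by norm_num)
      (φ.grading.lie_mem_of_add_eq ha hb (by norm_num)) fun w hw => ?_
    rw [LieGrading.killingForm_lie, hconj b hb w hw, map_zero]
  have h2 : ∀ z ∈ φ.piece 2, z = 0 := fun z hz =>
    φ.eq_zero_of_forall_lie_eq_zero hlevel (by norm_num) hz
      (hgen.lie_eq_zero fun y hy => h12 y hy z hz)
  have h1 : ∀ z ∈ φ.piece 1, z = 0 := fun z hz =>
    φ.eq_zero_of_forall_lie_eq_zero hlevel (by norm_num) hz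
      (hgen.lie_eq_zero fun y hy => h2 _ (φ.lie_mem 1 1 y z hy hz))
  -- Since `sInf ∅ = 0`, a positive level guarantees that a simple factor exists.
  obtain ⟨-, I, hI, -⟩ : {n : ℕ | ∃ I : LieIdeal ℝ (ℝ ⊗[K] L),
      LieAlgebra.IsSimple ℝ I ∧ n = φ.idealLevel I}.Nonempty :=
    Nat.nonempty_of_pos_sInf (lt_of_lt_of_le (by norm_num) hlevel)
  obtain ⟨m, hm, hne⟩ := φ.exists_piece_ne_bot hI (by norm_num) hlevel
  apply hne
  rw [Submodule.eq_bot_iff]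
  rintro w ⟨-, hw⟩
  have hspan : LieSubalgebra.lieSpan ℂ (ℂ ⊗[K] L) (φ.piece 1 : Set (ℂ ⊗[K] L)) ≤ ⊥ :=
    LieSubalgebra.lieSpan_le.2 fun z hz => (LieSubalgebra.mem_bot z).2 (h1 z hz)
  have hw' : w ∈ φ.plus :=
    Submodule.mem_iSup_of_mem (m : ℤ) (Submodule.mem_iSup_of_mem (by omega) hw)
  rw [← hgen] at hw'
  exact (LieSubalgebra.mem_bot w).1 (hspan hw')

end HodgeStructure
end HodgeLie

theorem proposition4p8 {K : Type*} [Field K] [Algebra K ℝ]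
    {L : Type*} [LieRing L] [LieAlgebra K L] [Module.Finite K L] [LieAlgebra.IsSemisimple K L]
    (φ : HodgeLie.HodgeStructure K L)
    (hgen : φ.OneGeneratesPlus) (hlevel : 3 ≤ φ.level) :
    (∀ H : LieSubalgebra K L, φ.IsSubHodge H →
      (∀ k : ℤ, 2 ≤ k → φ.subPiece H k = φ.piece k) →
        φ.subPlus H = φ.plus ∧
        (∀ x ∈ φ.piece (-2), ∀ y ∈ φ.piece 3, ⁅x, y⁆ ∈ φ.subPiece H 1)) ∧
    (φ.piece 1 ≤ φ.outer.toSubmodule ∧ φ.piece (-1) ≤ φ.outer.toSubmodule) ∧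
    (∃ x ∈ φ.piece (-2), ∃ y ∈ φ.piece 3, ⁅x, y⁆ ≠ 0) := by
  refine ⟨fun H _ hH => ?_, HodgeLie.HodgeStructure.piece_one_le hgen hlevel _ fun k hk => ?_,
    HodgeLie.HodgeStructure.exists_lie_ne_zero hgen hlevel⟩
  · have hO : ∀ k : ℤ, 2 ≤ k → φ.piece k ≤ (HodgeLie.complexSubalgebra H).toSubmodule ∧
        φ.piece (-k) ≤ (HodgeLie.complexSubalgebra H).toSubmodule := by
      intro k hk
      have hpos : φ.piece k ≤ H.toSubmodule.baseChange ℂ := by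
        rw [← hH k hk]; exact inf_le_left
      -- The complexification of `H` is stable under conjugation, which exchanges degrees `k` and
      -- `-k`.
      refine ⟨hpos, fun x hx => ?_⟩
      have hx' := φ.conj_mem _ x hx
      rw [neg_neg] at hx'
      rw [← HodgeLie.conj_conj x]
      exact HodgeLie.conj_mem_baseChange (hpos hx')
    have h1 := (HodgeLie.HodgeStructure.piece_one_le hgen hlevel _ hO).1
    refine ⟨le_antisymm (iSup₂_mono fun k _ => inf_le_right) (iSup₂_mono fun k hk => ?_),
      fun x hx y hy => ⟨?_, φ.grading.lie_mem_of_add_eq hx hy (by norm_num)⟩⟩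
    · rcases (show k = 1 ∨ 2 ≤ k by omega) with rfl | hk2
      · exact le_inf h1 le_rfl
      · exact (hH k hk2).ge
    · exact (HodgeLie.complexSubalgebra H).lie_mem ((hO 2 le_rfl).2 hx)
        ((hO 3 (by norm_num)).1 hy)
  · exact ⟨fun x hx => LieSubalgebra.subset_lieSpan ⟨k, hk, Or.inl hx⟩,
      fun x hx => LieSubalgebra.subset_lieSpan ⟨k, hk, Or.inr hx⟩⟩
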